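/- **Setting.** Let $S_\infty$ be the group of all permutations of $\omega$ with the topology of pointwise convergence and the metric $d(f,g)=2^{-\min\{k:\,f(k)\ne g(k)\}}$ ($f\neq g$), let $G$ be a closed subgroup of $S_\infty$, and let $(\mathbf X,\tau)$ be a compact Polish space, with a fixed compatible metric, on which $G$ acts continuously. Let $\mathcal N^G$ be the family of all sets $\{g\in G: g|_D=f|_D\}$ with $f\in G$ and $D\subset\omega$ finite, and $\mathcal V^G$ the family of all pointwise stabilizers in $G$ of finite sets $D\subset\omega$. For open $u\subseteq G$ and $B\subseteq \mathbf X$ let $B^{*u}$ (resp. $B^{\Delta u}$) be the set of all $x$ such that $\{g\in u: gx\in B\}$ is comeagre (resp. not meagre) in $u$. Let $\mathcal A$ be a countable basis of $\tau$, closed under $\cap$, each member of which is invariant under some $H\in\mathcal V^G$, and such that the clopen members of $\mathcal A$ generate $\tau$. Let $\mathcal B$ be a nice basis: a countable basis of a Polish topology $\mathbf t\supseteq\tau$ for which the action is still continuous, such that $\mathcal B$ is closed under $\cap$, under complements and under $B\mapsto B^{*u}$ for $u\in\mathcal N^G$, and each $B\in\mathcal B$ is invariant under some open subgroup of $G$.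 Assume that $\mathcal N^G$, $\mathcal A$ and $\mathcal B$ are 1-1-enumerated, each by (a decidable set of) natural numbers, so that $\mathcal B$ is computable. That is, the following are decidable in terms of the numbers: * in $\mathcal N^G$ and in $\mathcal A$: $\subseteq$, the graph of $\cap$, and the relation "$\mathrm{diam}(U)<2^{-i}$" for clopen $U$; the set of clopen members of $\mathcal A$; the set $\mathcal V^G$ as a subset of $\mathcal N^G$; * for $V\in\mathcal V^G$ and $U\in\mathcal A$: "$U$ is $V$-invariant"; * for all $m,n$: the relation "there is $g\in N$ with $V_{m+i}=gV_ig^{-1}$ for $1\le i\le m$ and $U_{n+j}=gU_j$ for $1\le j\le n$", where $N\in\mathcal N^G$, $V_1,\dots,V_{2m}\in\mathcal V^G$ and $U_1,\dots,U_{2n}\in\mathcal A$; * in $\mathcal B$: $\subseteq$, the graphs of complement and of $\cap$, "$B$ is $V$-invariant" ($V\in\mathcal V^G$), and the relations $B_1^{*u}=B_2$ and $B_1^{\Delta u}=B_2$ ($u\in\mathcal N^G$); and moreover $\mathcal A\subseteq\mathcal B$, and some computable function takes the number of each $A\in\mathcal A$ in $\mathcal A$ to its number in $\mathcal B$. A *$\tau$-canonical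 piece* is a non-empty set of the form $\bigcap_{A\in T}GA\cap\bigcap_{A\in\mathcal A\setminus T}(\mathbf X\setminus GA)$ with $T\subseteq\mathcal A$. A number $e$ *codes* a piece $Y$ if $\varphi_e$ is the (total) characteristic function of the set of numbers of those $A\in\mathcal A$ with $Y\subseteq GA$; $Y$ is *computable* if it has a code. For $e\in\omega$ and $B\in\mathcal B$ (given by its number), $\mathrm{Con}(e,B)$ holds if $e$ codes some $\tau$-canonical piece $Y$ with $B\cap Y\neq\emptyset$. **Proposition.** Under these assumptions there is a set $\mathcal O\subseteq\omega$ such that 1. every $e\in\mathcal O$ codes a computable $\tau$-canonical piece which is a $G$-orbit; 2. every code of a computable $\tau$-closed $\tau$-canonical piece which is a $G$-orbit belongs to $\mathcal O$; 3. $\mathcal O$ is $\Pi^0_3$ relative to $\mathrm{Con}$, i.e. there is a relation $R\subseteq\omega^4$, computable with oracle $\mathrm{Con}$, such that $e\in\mathcal O\iff\forall a\,\exists b\,\forall c\;R(e,a,b,c)$. -/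

import Mathlib

open scoped Pointwise

namespace PolishAction

/-! ### The group of permutations of the natural numbers and its closed subgroups -/

/-- The topology of pointwise convergence on the group of all permutations of `ℕ`
(`ℕ` is discrete). Closed subgroups carry the subspace topology. -/
instance permTopology : TopologicalSpace (Equiv.Perm ℕ) :=
  TopologicalSpace.induced (fun f : Equiv.Perm ℕ => (f : ℕ → ℕ)) inferInstance

open Classical in
/-- The usual left invariant metric: `d(f,g) = 2^(-min {k | f k ≠ g k})` for `f ≠ g`. -/
noncomputable def permDist (f g : Equiv.Perm ℕ) : ℝ :=
  if f = g then 0 else (1 / 2 : ℝ) ^ (sInf {k : ℕ | f k ≠ g k})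

/-- The family `𝒩^G` of all sets `{g ∈ G | g ⊇ σ}`, where `σ = f|_D` for some `f ∈ G` and
some finite `D ⊆ ℕ`. -/
def basicSets (G : Subgroup (Equiv.Perm ℕ)) : Set (Set G) :=
  {U | ∃ (f : G) (D : Finset ℕ),
    U = {g : G | ∀ k ∈ D, (g : Equiv.Perm ℕ) k = (f : Equiv.Perm ℕ) k}}

/-- The family `𝒱^G` of the basic subgroups: pointwise stabilizers in `G` of finite sets. -/
def basicSubgroups (G : Subgroup (Equiv.Perm ℕ)) : Set (Set G) :=
  {U | ∃ D : Finset ℕ, U = {g : G | ∀ k ∈ D, (g : Equiv.Perm ℕ) k = k}}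

/-- The diameter of `U` with respect to the distance `d` is less than `2^(-i)`. -/
def DiamLT {α : Type*} (d : α → α → ℝ) (U : Set α) (i : ℕ) : Prop :=
  ∃ r : ℝ, r < (1 / 2 : ℝ) ^ i ∧ ∀ x ∈ U, ∀ y ∈ U, d x y ≤ r

section Action

variable {G : Subgroup (Equiv.Perm ℕ)} {X : Type*} [MulAction G X]

/-! ### Saturations, Vaught transforms, invariance, canonical pieces -/

/-- `GA`, the union of all translates of `A`. -/
def saturation (G : Subgroup (Equiv.Perm ℕ)) {X : Type*} [MulAction G X] (A : Set X) : Set X :=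
  ⋃ g : G, g • A

/-- The Vaught transform `B^{*H}`: all `x` such that `{g ∈ H | gx ∈ B}` is comeagre in `H`. -/
def vaughtStar (B : Set X) (H : Set G) : Set X :=
  {x | {h : H | (h : G) • x ∈ B} ∈ residual H}

/-- The Vaught transform `B^{ΔH}`: all `x` such that `{g ∈ H | gx ∈ B}` is not meagre in `H`. -/
def vaughtDelta (B : Set X) (H : Set G) : Set X :=
  {x | ¬ IsMeagre {h : H | (h : G) • x ∈ B}}

/-- `B` is invariant under the elements of `H` (which is always a subgroup below). -/
def InvariantUnder (H : Set G) (B : Set X) : Prop :=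
  ∀ g ∈ H, ∀ x ∈ B, g • x ∈ B

/-- `Y` is a piece of the canonical partition of the `G`-space with basis `𝒜`: a nonempty set
of the form `⋂ {GA | A ∈ T} ∩ ⋂ {X \ GA | A ∈ 𝒜 \ T}` for some `T ⊆ 𝒜`. -/
def IsCanonicalPiece (G : Subgroup (Equiv.Perm ℕ)) {X : Type*} [MulAction G X]
    (𝒜 : Set (Set X)) (Y : Set X) : Prop :=
  Y.Nonempty ∧ ∃ T ⊆ 𝒜,
    Y = (⋂ A ∈ T, saturation G A) ∩ (⋂ A ∈ 𝒜 \ T, (saturation G A)ᶜ)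

/-! ### Bases of the space -/

/-- The requirements on the basis `𝒜` of the given topology of `X`. -/
structure IsAdmissibleBasis (G : Subgroup (Equiv.Perm ℕ)) {X : Type*} [MulAction G X]
    [TopologicalSpace X] (𝒜 : Set (Set X)) : Prop where
  countable : 𝒜.Countable
  basis : TopologicalSpace.IsTopologicalBasis 𝒜
  inter_mem : ∀ A₁ ∈ 𝒜, ∀ A₂ ∈ 𝒜, A₁ ∩ A₂ ∈ 𝒜
  invariant : ∀ A ∈ 𝒜, ∃ H ∈ basicSubgroups G, InvariantUnder H A
  clopen_generate : TopologicalSpace.generateFrom {A ∈ 𝒜 | IsClopen A} =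
    (inferInstance : TopologicalSpace X)

/-- `t` is a nice topology for the `G`-space `X` (with its given topology `τ`), and `ℬ` is a
nice basis of `t`. In Mathlib `t ≤ τ` means that `t` is finer than `τ`. -/
structure IsNiceBasisOf (G : Subgroup (Equiv.Perm ℕ)) {X : Type*} [MulAction G X]
    [τ : TopologicalSpace X] (t : TopologicalSpace X) (ℬ : Set (Set X)) : Prop where
  polish : @PolishSpace X t
  finer : t ≤ τ
  continuous_smul : @ContinuousSMul G X _ _ t
  basis : @TopologicalSpace.IsTopologicalBasis X t ℬ
  countable : ℬ.Countable
  inter_mem : ∀ B₁ ∈ ℬ, ∀ B₂ ∈ ℬ, B₁ ∩ B₂ ∈ ℬ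
  compl_mem : ∀ B ∈ ℬ, Bᶜ ∈ ℬ
  vaughtStar_mem : ∀ B ∈ ℬ, ∀ u ∈ basicSets G, vaughtStar B u ∈ ℬ
  invariant : ∀ B ∈ ℬ, ∃ H : Subgroup G, IsOpen (H : Set G) ∧ InvariantUnder (H : Set G) B

/-- `ℬ` is a nice basis, that is a nice basis of some nice topology for the `G`-space `X`
(which is determined by `ℬ`). -/
def IsNiceBasis (G : Subgroup (Equiv.Perm ℕ)) {X : Type*} [MulAction G X]
    [TopologicalSpace X] (ℬ : Set (Set X)) : Prop :=
  ∃ t, IsNiceBasisOf G t ℬ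

/-! ### Computable presentations -/

/-- A 1-1-enumeration of the family `𝒞` by the elements of a decidable set of natural numbers
(which may be finite, since `𝒞` may be finite). Outside `dom` the values are irrelevant. -/
structure FamilyNumbering {α : Type*} (𝒞 : Set α) where
  dom : Set ℕ
  val : ℕ → α
  bijOn : Set.BijOn val dom 𝒞
  dom_computable : ComputablePred (fun n : ℕ => n ∈ dom)

/-- The bases `𝒩^G` and `𝒜` are computably 1-1-enumerated, so that all the relations below
are decidable. -/
structure IsComputablePresentation {X : Type*} [MetricSpace X]
    {G : Subgroup (Equiv.Perm ℕ)} [MulAction G X] {𝒜 : Set (Set X)}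
    (νN : FamilyNumbering (basicSets G)) (νA : FamilyNumbering 𝒜) : Prop where
  /-- inclusion and intersection in `𝒩^G` -/
  subset_N : ComputablePred fun p : ℕ × ℕ =>
    p.1 ∈ νN.dom ∧ p.2 ∈ νN.dom ∧ νN.val p.1 ⊆ νN.val p.2
  inter_N : ComputablePred fun p : ℕ × ℕ × ℕ =>
    p.1 ∈ νN.dom ∧ p.2.1 ∈ νN.dom ∧ p.2.2 ∈ νN.dom ∧
      νN.val p.1 ∩ νN.val p.2.1 = νN.val p.2.2
  /-- inclusion and intersection in `𝒜` -/
  subset_A : ComputablePred fun p : ℕ × ℕ =>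
    p.1 ∈ νA.dom ∧ p.2 ∈ νA.dom ∧ νA.val p.1 ⊆ νA.val p.2
  inter_A : ComputablePred fun p : ℕ × ℕ × ℕ =>
    p.1 ∈ νA.dom ∧ p.2.1 ∈ νA.dom ∧ p.2.2 ∈ νA.dom ∧
      νA.val p.1 ∩ νA.val p.2.1 = νA.val p.2.2
  /-- the predicates `Clopen` on `𝒜` and `𝒱^G` on `𝒩^G` -/
  clopen_A : ComputablePred fun n : ℕ => n ∈ νA.dom ∧ IsClopen (νA.val n)
  basicSubgroup_N : ComputablePred fun n : ℕ =>
    n ∈ νN.dom ∧ νN.val n ∈ basicSubgroups G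
  /-- the diameter of a basic clopen set is less than `2^(-i)` (all members of `𝒩^G` are
  clopen) -/
  diam_N : ComputablePred fun p : ℕ × ℕ =>
    p.1 ∈ νN.dom ∧
      DiamLT (fun f g : G => permDist (f : Equiv.Perm ℕ) (g : Equiv.Perm ℕ)) (νN.val p.1) p.2
  diam_A : ComputablePred fun p : ℕ × ℕ =>
    p.1 ∈ νA.dom ∧ IsClopen (νA.val p.1) ∧
      DiamLT (fun x y : X => dist x y) (νA.val p.1) p.2
  /-- `Inv(V, U)` -/
  inv_A : ComputablePred fun p : ℕ × ℕ =>
    (p.1 ∈ νN.dom ∧ νN.val p.1 ∈ basicSubgroups G) ∧ p.2 ∈ νA.dom ∧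
      InvariantUnder (νN.val p.1) (νA.val p.2)
  /-- `Orb_{m,n}(N, V, V', U, U')`: some `g ∈ N` satisfies `V'ᵢ = g Vᵢ g⁻¹` and `U'ⱼ = g Uⱼ`
  for all `i < m` and `j < n` -/
  orb : ∀ m n : ℕ, ComputablePred
    fun p : ℕ × (Fin m → ℕ) × (Fin m → ℕ) × (Fin n → ℕ) × (Fin n → ℕ) =>
      p.1 ∈ νN.dom ∧
      (∀ i, p.2.1 i ∈ νN.dom ∧ νN.val (p.2.1 i) ∈ basicSubgroups G) ∧
      (∀ i, p.2.2.1 i ∈ νN.dom ∧ νN.val (p.2.2.1 i) ∈ basicSubgroups G) ∧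
      (∀ j, p.2.2.2.1 j ∈ νA.dom) ∧
      (∀ j, p.2.2.2.2 j ∈ νA.dom) ∧
      ∃ g ∈ νN.val p.1,
        (∀ i, νN.val (p.2.2.1 i) = (fun v => g * v * g⁻¹) '' νN.val (p.2.1 i)) ∧
        (∀ j, νA.val (p.2.2.2.2 j) = g • νA.val (p.2.2.2.1 j))

/-- The basis `ℬ`, enumerated by `νB`, is computable (over the enumerations of `𝒩^G` and `𝒜`). -/
structure IsComputableBasis {X : Type*} [MetricSpace X]
    {G : Subgroup (Equiv.Perm ℕ)} [MulAction G X] {𝒜 ℬ : Set (Set X)}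
    (νN : FamilyNumbering (basicSets G)) (νA : FamilyNumbering 𝒜) (νB : FamilyNumbering ℬ) : Prop where
  presentation : IsComputablePresentation νN νA
  /-- a computable function finding the `ℬ`-numbers of the elements of `𝒜` -/
  translation : ∃ f : ℕ → ℕ, Computable f ∧
    ∀ n ∈ νA.dom, f n ∈ νB.dom ∧ νB.val (f n) = νA.val n
  subset_B : ComputablePred fun p : ℕ × ℕ =>
    p.1 ∈ νB.dom ∧ p.2 ∈ νB.dom ∧ νB.val p.1 ⊆ νB.val p.2
  compl_B : ComputablePred fun p : ℕ × ℕ =>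
    p.1 ∈ νB.dom ∧ p.2 ∈ νB.dom ∧ νB.val p.2 = (νB.val p.1)ᶜ
  inv_B : ComputablePred fun p : ℕ × ℕ =>
    (p.1 ∈ νN.dom ∧ νN.val p.1 ∈ basicSubgroups G) ∧ p.2 ∈ νB.dom ∧
      InvariantUnder (νN.val p.1) (νB.val p.2)
  inter_B : ComputablePred fun p : ℕ × ℕ × ℕ =>
    p.1 ∈ νB.dom ∧ p.2.1 ∈ νB.dom ∧ p.2.2 ∈ νB.dom ∧
      νB.val p.1 ∩ νB.val p.2.1 = νB.val p.2.2
  vaughtStar_B : ComputablePred fun p : ℕ × ℕ × ℕ =>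
    p.1 ∈ νB.dom ∧ p.2.1 ∈ νN.dom ∧ p.2.2 ∈ νB.dom ∧
      vaughtStar (νB.val p.1) (νN.val p.2.1) = νB.val p.2.2
  vaughtDelta_B : ComputablePred fun p : ℕ × ℕ × ℕ =>
    p.1 ∈ νB.dom ∧ p.2.1 ∈ νN.dom ∧ p.2.2 ∈ νB.dom ∧
      vaughtDelta (νB.val p.1) (νN.val p.2.1) = νB.val p.2.2

/-! ### Codes of pieces, and the relation `Con` -/

/-- `φ_e`, the partial computable function with index `e`. -/
def phi (e : ℕ) : ℕ →. ℕ := (Denumerable.ofNat Nat.Partrec.Code e).eval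

open Classical in
/-- `e` codes `Y`: `φ_e` is (total and is) the characteristic function of the set of all
numbers of those `A ∈ 𝒜` with `Y ⊆ GA`. In particular the piece `Y` is then computable
(decidable). -/
def Codes {𝒜 : Set (Set X)} (νA : FamilyNumbering 𝒜) (e : ℕ) (Y : Set X) : Prop :=
  ∀ n : ℕ, phi e n =
    Part.some (if n ∈ νA.dom ∧ Y ⊆ saturation G (νA.val n) then 1 else 0)

/-- `Con(e, B)`, where `B` is given by its number `b`. -/
def ConRel (G : Subgroup (Equiv.Perm ℕ)) {X : Type*} [MulAction G X] {𝒜 ℬ : Set (Set X)}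
    (νA : FamilyNumbering 𝒜) (νB : FamilyNumbering ℬ) (e b : ℕ) : Prop :=
  b ∈ νB.dom ∧ ∃ Y : Set X, IsCanonicalPiece G 𝒜 Y ∧ (νB.val b ∩ Y).Nonempty ∧
    Codes (G := G) νA e Y

end Action

/-! ### The relativized arithmetical class `Π⁰₃` -/

open Classical in
/-- The characteristic function of a binary relation, as an oracle. -/
noncomputable def relOracle (R : ℕ → ℕ → Prop) : ℕ →. ℕ :=
  fun n => Part.some (if R n.unpair.1 n.unpair.2 then 1 else 0)

/-- `S` is `Π⁰₃` relative to the binary relation `R`. -/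
def IsPiThreeIn (R : ℕ → ℕ → Prop) (S : Set ℕ) : Prop :=
  ∃ f : ℕ × ℕ × ℕ × ℕ → Bool, ComputableIn {relOracle R} f ∧
    ∀ e, e ∈ S ↔ ∀ a, ∃ b, ∀ c, f (e, a, b, c) = true

end PolishAction

open PolishAction

open scoped Pointwise
open Filter Topology

/-! ### Oracle computability -/

namespace ComputableIn

variable {α β γ : Type*} [Primcodable α] [Primcodable β] [Primcodable γ] {O : Set (ℕ →. ℕ)}

/-! Every orbit inside a canonical piece `Y` is dense in `Y`, so `Y` is a single orbit as soon as
points with the same orbit closure can be joined by a group element. The criterion is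
`HasUniformLocalOrbits`: for each basic subgroup `V` there is a scale below which all points of `Y`
in a common clopen basic set `A` have `V`-orbits meeting the same basic sets `A'` that meet `A ∩ Y`.

This suffices: the local orbit closures allow a back-and-forth construction of two convergent
sequences in the closed group `G` that move `x` and `y` to a common limit
(`mem_orbit_of_locally_dense`). It is necessary when `Y` is a closed, hence compact, orbit: by Baire
category local orbit closures have relative interior, and a Lebesgue number makes this uniform
(`exists_dist_lt_mem_closure_local_orbit`).

For open `A'` the transform `A'^{ΔV}` is the `V`-saturation of `A'`, so the criterion forbids `Y` to
meet both `A ∩ A'` and `A \ A'^{ΔV}`. Both sets lie in `ℬ`, with numbers that can be checked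
effectively, so `Con` decides each instance and the quantifiers are ∀ subgroup, ∃ scale, ∀ instance.
-/

theorem comp {f : β → γ} {g : α → β} (hf : ComputableIn O f) (hg : ComputableIn O g) :
    ComputableIn O fun a => f (g a) := by
  refine (Nat.RecursiveIn.comp hf hg).of_eq fun n => ?_
  cases h : Encodable.decode (α := α) n <;> simp

theorem pair {f : α → β} {g : α → γ} (hf : ComputableIn O f) (hg : ComputableIn O g) :
    ComputableIn O fun a => (f a, g a) := by
  refine (Nat.RecursiveIn.pair hf hg).of_eq fun n => ?_
  cases h : Encodable.decode (α := α) n <;> simp [Seq.seq]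

theorem and {f g : α → Bool} (hf : ComputableIn O f) (hg : ComputableIn O g) :
    ComputableIn O fun a => f a && g a :=
  (Primrec.and.computableIn₂ (O := O)).comp (hf.pair hg)

theorem not {f : α → Bool} (hf : ComputableIn O f) : ComputableIn O fun a => !f a :=
  (Primrec.not.computableIn (O := O)).comp hf

open Classical in
theorem decide_comp {p : β → Prop} (hp : ComputablePred p) {g : α → β} (hg : Computable g) :
    ComputableIn O fun a => decide (p (g a)) :=
  (hp.decide.computableIn (O := O)).comp hg.computableIn

end ComputableIn

namespace PolishAction

open Classical in
theorem computableIn_relOracle (R : ℕ → ℕ → Prop) :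
    ComputableIn {relOracle R} fun p : ℕ × ℕ => decide (R p.1 p.2) := by
  have h : ComputableIn {relOracle R} fun n : ℕ => if R n.unpair.1 n.unpair.2 then 1 else 0 :=
    RecursiveIn.oracle _ (Set.mem_singleton _)
  have hb : Computable fun n : ℕ => decide (n = 1) :=
    (Primrec.eq.decide.comp Primrec.id (Primrec.const 1)).to_comp
  have hp : Computable fun p : ℕ × ℕ => Nat.pair p.1 p.2 :=
    (Primrec₂.natPair.comp Primrec.fst Primrec.snd).to_comp
  have := (hb.computableIn (O := {relOracle R})).comp (h.comp hp.computableIn)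
  convert this using 2 with p
  by_cases hR : R p.1 p.2 <;> simp [hR]

theorem exists_computable_surjective_nat_prod {α : Type*} [Primcodable α]
    (h : ∃ s : ℕ → α, Computable s ∧ s.Surjective) :
    ∃ s : ℕ → ℕ × α, Computable s ∧ s.Surjective := by
  obtain ⟨s, hs, hsurj⟩ := h
  refine ⟨fun n => (n.unpair.1, s n.unpair.2), ?_, ?_⟩
  · exact (Computable.fst.comp Computable.unpair).pair
      (hs.comp (Computable.snd.comp Computable.unpair))
  · rintro ⟨m, a⟩
    obtain ⟨k, rfl⟩ := hsurj a
    exact ⟨Nat.pair m k, by simp⟩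

/-- A `Π⁰₃` definition may quantify over elements of any effectively enumerated types. -/
theorem isPiThreeIn_of_surjective {α β γ : Type*} [Primcodable α] [Primcodable β] [Primcodable γ]
    (hα : ∃ s : ℕ → α, Computable s ∧ s.Surjective) (hβ : ∃ s : ℕ → β, Computable s ∧ s.Surjective)
    (hγ : ∃ s : ℕ → γ, Computable s ∧ s.Surjective) {R : ℕ → ℕ → Prop} {S : Set ℕ}
    {f : ℕ × α × β × γ → Bool} (hf : ComputableIn {relOracle R} f)
    (hS : ∀ e, e ∈ S ↔ ∀ a, ∃ b, ∀ c, f (e, a, b, c) = true) : IsPiThreeIn R S := by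
  obtain ⟨s, hs, hsurj⟩ := hα
  obtain ⟨t, ht, htsurj⟩ := hβ
  obtain ⟨u, hu, husurj⟩ := hγ
  refine ⟨fun p => f (p.1, s p.2.1, t p.2.2.1, u p.2.2.2), hf.comp (Computable.computableIn ?_),
    fun e => ?_⟩
  · exact Computable.fst.pair ((hs.comp (Computable.fst.comp Computable.snd)).pair
      ((ht.comp (Computable.fst.comp (Computable.snd.comp Computable.snd))).pair
      (hu.comp (Computable.snd.comp (Computable.snd.comp Computable.snd)))))
  · rw [hS, hsurj.forall]
    refine forall_congr' fun a => ?_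
    rw [htsurj.exists]
    exact exists_congr fun b => husurj.forall

/-! ### The topology of the permutation group -/

theorem continuous_perm_apply (k : ℕ) : Continuous fun g : Equiv.Perm ℕ => g k :=
  (continuous_apply k).comp continuous_induced_dom

theorem continuous_perm_symm_apply (k : ℕ) : Continuous fun g : Equiv.Perm ℕ => g.symm k := by
  refine continuous_discrete_rng.2 fun m => ?_
  have : (fun g : Equiv.Perm ℕ => g.symm k) ⁻¹' {m} = (fun g : Equiv.Perm ℕ => g m) ⁻¹' {k} := by
    ext g
    simp only [Set.mem_preimage, Set.mem_singleton_iff, Equiv.symm_apply_eq]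
    exact eq_comm
  rw [this]
  exact (isOpen_discrete _).preimage (continuous_perm_apply m)

/-- Recording the inverse makes the range closed, being cut out by the equations for mutually
inverse maps; `g` alone would not do, since limits of permutations may fail to be surjective. -/
theorem isClosedEmbedding_perm :
    IsClosedEmbedding fun g : Equiv.Perm ℕ => ((g : ℕ → ℕ), (g.symm : ℕ → ℕ)) := by
  have hcont : Continuous fun g : Equiv.Perm ℕ => ((g : ℕ → ℕ), (g.symm : ℕ → ℕ)) :=
    (continuous_pi continuous_perm_apply).prodMk (continuous_pi continuous_perm_symm_apply)
  refine ⟨⟨IsInducing.of_comp hcont continuous_fst ⟨rfl⟩, fun f g h => ?_⟩, ?_⟩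
  · exact DFunLike.coe_injective (Prod.ext_iff.1 h).1
  · have heval : Continuous fun q : (ℕ → ℕ) × ℕ => q.1 q.2 :=
      continuous_prod_of_discrete_right.2 fun k => continuous_apply k
    have hrange : Set.range (fun g : Equiv.Perm ℕ => ((g : ℕ → ℕ), (g.symm : ℕ → ℕ))) =
        {p | ∀ k, p.1 (p.2 k) = k ∧ p.2 (p.1 k) = k} := by
      ext p
      constructor
      · rintro ⟨g, rfl⟩ k
        simp
      · intro h
        exact ⟨⟨p.1, p.2, fun k => (h k).2, fun k => (h k).1⟩, rfl⟩
    rw [hrange, Set.ofPred_forall]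
    refine isClosed_iInter fun k => IsClosed.inter ?_ ?_
    · exact isClosed_eq (heval.comp (continuous_fst.prodMk
        ((continuous_apply k).comp continuous_snd))) continuous_const
    · exact isClosed_eq (heval.comp (continuous_snd.prodMk
        ((continuous_apply k).comp continuous_fst))) continuous_const

instance polishSpace_perm : PolishSpace (Equiv.Perm ℕ) :=
  isClosedEmbedding_perm.polishSpace

theorem tendsto_perm {ι : Type*} {l : Filter ι} {s : ι → Equiv.Perm ℕ} {g : Equiv.Perm ℕ}
    (h : ∀ k, ∀ᶠ n in l, s n k = g k) : Tendsto s l (𝓝 g) := by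
  have : IsInducing fun f : Equiv.Perm ℕ => (f : ℕ → ℕ) := ⟨rfl⟩
  refine this.tendsto_nhds_iff.2 (tendsto_pi_nhds.2 fun k => ?_)
  exact tendsto_const_nhds.congr' ((h k).mono fun n hn => hn.symm)

/-- A sequence of permutations which, together with the sequence of the inverses, is eventually
constant at every number has a limit. -/
theorem exists_tendsto_perm {s : ℕ → Equiv.Perm ℕ}
    (h : ∀ n, ∀ k < n, s (n + 1) k = s n k ∧ (s (n + 1))⁻¹ k = (s n)⁻¹ k) :
    ∃ g, Tendsto s atTop (𝓝 g) := by
  have hs : ∀ k m, k + 1 ≤ m → s m k = s (k + 1) k ∧ (s m)⁻¹ k = (s (k + 1))⁻¹ k := by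
    intro k m hm
    induction m, hm using Nat.le_induction with
    | base => exact ⟨rfl, rfl⟩
    | succ m hm ih => exact ⟨(h m k hm).1.trans ih.1, (h m k hm).2.trans ih.2⟩
  let g : Equiv.Perm ℕ :=
    { toFun := fun k => s (k + 1) k
      invFun := fun k => (s (k + 1))⁻¹ k
      left_inv := fun k => by
        -- At this stage both the value at `k` and the inverse at that value have become stationary.
        have h1 := hs k (max (k + 1) (s (k + 1) k + 1)) (le_max_left _ _)
        have h2 := hs (s (k + 1) k) (max (k + 1) (s (k + 1) k + 1)) (le_max_right _ _)
        refine h2.2.symm.trans ?_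
        rw [Equiv.Perm.inv_eq_iff_eq]
        exact h1.1.symm
      right_inv := fun k => by
        have h1 := hs k (max (k + 1) ((s (k + 1))⁻¹ k + 1)) (le_max_left _ _)
        have h2 := hs ((s (k + 1))⁻¹ k) (max (k + 1) ((s (k + 1))⁻¹ k + 1)) (le_max_right _ _)
        refine h2.1.symm.trans ?_
        rw [← Equiv.Perm.eq_inv_iff_eq]
        exact h1.2.symm }
  exact ⟨g, tendsto_perm fun k => (eventually_ge_atTop (k + 1)).mono fun m hm => (hs k m hm).1⟩

/-! ### Pointwise stabilizers and Vaught transforms along them -/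

section Stabilizers

variable (G : Subgroup (Equiv.Perm ℕ))

/-- The pointwise stabilizer in `G` of a finite set, as a subgroup. -/
def pointwiseStabilizer (D : Finset ℕ) : Subgroup G where
  carrier := {g : G | ∀ k ∈ D, (g : Equiv.Perm ℕ) k = k}
  one_mem' := fun k _ => rfl
  mul_mem' := fun {a b} ha hb k hk => by
    simp [hb k hk, ha k hk]
  inv_mem' := fun {a} ha k hk => by
    rw [Subgroup.coe_inv, Equiv.Perm.inv_eq_iff_eq]
    exact (ha k hk).symm

variable {G}

theorem mem_pointwiseStabilizer {D : Finset ℕ} {g : G} :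
    g ∈ pointwiseStabilizer G D ↔ ∀ k ∈ D, (g : Equiv.Perm ℕ) k = k := Iff.rfl

theorem mem_basicSubgroups {U : Set G} :
    U ∈ basicSubgroups G ↔ ∃ D, U = pointwiseStabilizer G D := Iff.rfl

theorem pointwiseStabilizer_mem_basicSets (D : Finset ℕ) :
    (pointwiseStabilizer G D : Set G) ∈ basicSets G :=
  ⟨1, D, rfl⟩

theorem isClosed_pointwiseStabilizer (D : Finset ℕ) :
    IsClosed (pointwiseStabilizer G D : Set G) := by
  have : (pointwiseStabilizer G D : Set G) =
      ⋂ k ∈ D, {g : G | (g : Equiv.Perm ℕ) k = k} := by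
    ext g; simp [mem_pointwiseStabilizer]
  rw [this]
  exact isClosed_biInter fun k _ =>
    isClosed_eq ((continuous_perm_apply k).comp continuous_subtype_val) continuous_const

theorem baireSpace_pointwiseStabilizer (hG : IsClosed (G : Set (Equiv.Perm ℕ))) (D : Finset ℕ) :
    BaireSpace (pointwiseStabilizer G D : Set G) := by
  have : PolishSpace G := hG.isClosedEmbedding_subtypeVal.polishSpace
  have : PolishSpace (pointwiseStabilizer G D : Set G) :=
    (isClosed_pointwiseStabilizer D).isClosedEmbedding_subtypeVal.polishSpace
  infer_instance

/-- Vaught transforms of open sets along basic subgroups are local saturations. -/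
theorem mem_vaughtDelta_iff {X : Type*} [TopologicalSpace X] [MulAction G X] [ContinuousSMul G X]
    (hG : IsClosed (G : Set (Equiv.Perm ℕ))) (D : Finset ℕ) {A : Set X} (hA : IsOpen A) {x : X} :
    x ∈ vaughtDelta A (pointwiseStabilizer G D : Set G) ↔
      ∃ g ∈ pointwiseStabilizer G D, g • x ∈ A := by
  have := baireSpace_pointwiseStabilizer hG D
  constructor
  · intro h
    by_contra! hne
    refine h ?_
    have : {h : (pointwiseStabilizer G D : Set G) | (h : G) • x ∈ A} = ∅ :=
      Set.eq_empty_of_forall_notMem fun g hg => hne g g.2 hg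
    rw [this]
    exact IsMeagre.empty
  · rintro ⟨g, hg, hgx⟩
    -- A non-empty open subset of a Baire space is not meagre.
    refine not_isMeagre_of_isOpen (hA.preimage ?_) ⟨⟨g, hg⟩, hgx⟩
    exact continuous_subtype_val.smul continuous_const

end Stabilizers

variable {G : Subgroup (Equiv.Perm ℕ)} {X : Type*} [MulAction G X]

/-! ### Closures of local orbits -/

section LocalOrbits

theorem smul_mem_orbit_of_mem {V : Subgroup G} {g : G} (hg : g ∈ V) (x : X) :
    g • x ∈ MulAction.orbit V x :=
  ⟨⟨g, hg⟩, rfl⟩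

variable [TopologicalSpace X] [ContinuousSMul G X] {V : Subgroup G} {x y z : X}

theorem smul_mem_closure_orbit {g : G} (hg : g ∈ V) (hy : y ∈ closure (MulAction.orbit V x)) :
    g • y ∈ closure (MulAction.orbit V x) := by
  refine map_mem_closure (continuous_const_smul g) hy ?_
  rintro _ ⟨v, rfl⟩
  exact ⟨⟨g, hg⟩ * v, mul_smul _ _ _⟩

theorem mem_closure_orbit_trans (hxy : x ∈ closure (MulAction.orbit V y))
    (hyz : y ∈ closure (MulAction.orbit V z)) : x ∈ closure (MulAction.orbit V z) := by
  refine closure_minimal ?_ isClosed_closure hxy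
  rintro _ ⟨v, rfl⟩
  exact smul_mem_closure_orbit v.2 hyz

end LocalOrbits

/-! ### The back-and-forth argument -/

section BackAndForth

/-- A finite set whose stabilizer moves `g` so little that neither `g` nor `g⁻¹` changes at the
numbers less than `n`. -/
def controlSet (n : ℕ) (g : G) : Finset ℕ :=
  Finset.range n ∪ (Finset.range n).image (g : Equiv.Perm ℕ)

theorem mul_apply_of_mem_stabilizer {n k : ℕ} (hk : k < n) {v g : G}
    (hv : v ∈ pointwiseStabilizer G (controlSet n g)) :
    ((v * g : G) : Equiv.Perm ℕ) k = (g : Equiv.Perm ℕ) k ∧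
      ((v * g : G) : Equiv.Perm ℕ)⁻¹ k = (g : Equiv.Perm ℕ)⁻¹ k := by
  have hk' := Finset.mem_range.2 hk
  constructor
  · exact hv _ (Finset.mem_union_right _ (Finset.mem_image_of_mem _ hk'))
  · have h1 : (v : Equiv.Perm ℕ) k = k := hv k (Finset.mem_union_left _ hk')
    have h2 : (v : Equiv.Perm ℕ)⁻¹ k = k := Equiv.Perm.inv_eq_iff_eq.2 h1.symm
    rw [Subgroup.coe_mul, mul_inv_rev, Equiv.Perm.mul_apply, h2]

variable [MetricSpace X] [ContinuousSMul G X]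

/-- If the closures of the local orbits are relatively open in the invariant set `Y` (and any two
of them are equal or disjoint), then two elements of `Y` with the same orbit closure have the same
orbit. -/
theorem mem_orbit_of_locally_dense (hG : IsClosed (G : Set (Equiv.Perm ℕ))) {Y : Set X}
    (hY : ∀ g : G, ∀ z ∈ Y, g • z ∈ Y)
    (hloc : ∀ D : Finset ℕ, ∀ z ∈ Y, ∃ U ∈ 𝓝 z, ∀ u ∈ U ∩ Y, ∀ w ∈ U ∩ Y,
      u ∈ closure (MulAction.orbit (pointwiseStabilizer G D) w))
    {x y : X} (hx : x ∈ Y) (hy : y ∈ Y) (hxy : y ∈ closure (MulAction.orbit G x)) :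
    y ∈ MulAction.orbit G x := by
  -- One half of the back-and-forth: `w` moves close to `z`, and the roles of the two points are
  -- exchanged for the next local group.
  have half : ∀ D E : Finset ℕ, ∀ ε > 0, ∀ z ∈ Y, ∀ w ∈ Y,
      z ∈ closure (MulAction.orbit (pointwiseStabilizer G D) w) →
      ∃ v ∈ pointwiseStabilizer G D, dist (v • w) z < ε ∧
        v • w ∈ closure (MulAction.orbit (pointwiseStabilizer G E) z) := by
    intro D E ε hε z hz w hw hzw
    obtain ⟨U, hU, hUz⟩ := hloc E z hz
    obtain ⟨_, ⟨hu, hball⟩, ⟨v, rfl⟩⟩ :=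
      mem_closure_iff_nhds.1 hzw _ (inter_mem hU (Metric.ball_mem_nhds z hε))
    exact ⟨v, v.2, hball, hUz _ ⟨hu, hY _ _ hw⟩ _ ⟨mem_of_mem_nhds hU, hz⟩⟩
  let P : ℕ → G × G → Prop := fun n p =>
    p.2 • y ∈ closure (MulAction.orbit (pointwiseStabilizer G (controlSet n p.1)) (p.1 • x))
  let Q : ℕ → G × G → G × G → Prop := fun n p q =>
    (∃ v ∈ pointwiseStabilizer G (controlSet n p.1), q.1 = v * p.1) ∧
    (∃ v ∈ pointwiseStabilizer G (controlSet n p.2), q.2 = v * p.2) ∧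
    dist (q.1 • x) (q.2 • y) < (1 / 2 : ℝ) ^ n
  have step : ∀ n p, P n p → ∃ q, P (n + 1) q ∧ Q n p q := by
    rintro n ⟨g, h⟩ hp
    -- The radius 1 is a dummy; only the second move has to bring the points together.
    obtain ⟨v, hv, -, hvg⟩ := half _ (controlSet n h) 1 one_pos _ (hY h y hy) _ (hY g x hx) hp
    obtain ⟨w, hw, hd, hwh⟩ := half _ (controlSet (n + 1) (v * g)) ((1 / 2 : ℝ) ^ n) (by positivity)
      _ (hY v _ (hY g x hx)) _ (hY h y hy) hvg
    refine ⟨(v * g, w * h), ?_, ⟨v, hv, rfl⟩, ⟨w, hw, rfl⟩, ?_⟩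
    · simpa only [P, mul_smul] using hwh
    · simpa only [mul_smul, dist_comm] using hd
  -- The control set is empty at stage 0, so the local group is all of `G`.
  have start : P 0 (1, 1) := by
    have : ∀ g : G, g ∈ pointwiseStabilizer G (controlSet 0 (1 : G)) := fun g k hk => by
      simp [controlSet] at hk
    simp only [P, one_smul]
    refine closure_mono ?_ hxy
    rintro _ ⟨g, rfl⟩
    exact smul_mem_orbit_of_mem (this g) x
  choose! next hnextP hnextQ using step
  let s : ℕ → G × G := fun n => Nat.rec (1, 1) (fun n p => next n p) n
  have hP : ∀ n, P n (s n) := by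
    intro n
    induction n with
    | zero => exact start
    | succ n ih => exact hnextP n _ ih
  have hQ : ∀ n, Q n (s n) (s (n + 1)) := fun n => hnextQ n _ (hP n)
  have lim : ∀ t : ℕ → G,
      (∀ n, ∃ v ∈ pointwiseStabilizer G (controlSet n (t n)), t (n + 1) = v * t n) →
      ∃ g : G, Tendsto t atTop (𝓝 g) := by
    intro t ht
    obtain ⟨g, hg⟩ := exists_tendsto_perm (s := fun n => (t n : Equiv.Perm ℕ)) (by
      intro n k hk
      obtain ⟨v, hv, hvt⟩ := ht n
      rw [hvt]
      exact mul_apply_of_mem_stabilizer hk hv)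
    exact ⟨⟨g, hG.mem_of_tendsto hg (Eventually.of_forall fun n => (t n).2)⟩,
      tendsto_subtype_rng.2 hg⟩
  obtain ⟨g, hg⟩ := lim (fun n => (s n).1) fun n => (hQ n).1
  obtain ⟨h, hh⟩ := lim (fun n => (s n).2) fun n => (hQ n).2.1
  have hdist : Tendsto (fun n => dist ((s (n + 1)).1 • x) ((s (n + 1)).2 • y)) atTop
      (𝓝 (dist (g • x) (h • y))) :=
    (((tendsto_add_atTop_iff_nat 1).2 hg).smul_const x).dist
      (((tendsto_add_atTop_iff_nat 1).2 hh).smul_const y)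
  have hzero : Tendsto (fun n => dist ((s (n + 1)).1 • x) ((s (n + 1)).2 • y)) atTop (𝓝 0) :=
    squeeze_zero (fun _ => dist_nonneg) (fun n => (hQ n).2.2.le)
      (tendsto_pow_atTop_nhds_zero_of_lt_one (by norm_num) (by norm_num))
  have heq : g • x = h • y := dist_eq_zero.1 (tendsto_nhds_unique hdist hzero)
  exact ⟨h⁻¹ * g, by simp [mul_smul, heq]⟩

end BackAndForth

/-! ### Compact orbits -/

section CompactOrbits

/-- In a compact orbit the closures of local orbits have interior points. -/
theorem exists_open_subset_closure_local_orbit [TopologicalSpace X] [T2Space X]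
    [ContinuousSMul G X] {Y : Set X} (hY : IsCompact Y) {z : X} (hz : Y = MulAction.orbit G z)
    (D : Finset ℕ) :
    ∃ U : Set X, IsOpen U ∧ z ∈ U ∧
      U ∩ Y ⊆ closure (MulAction.orbit (pointwiseStabilizer G D) z) := by
  have : CompactSpace Y := isCompact_iff_compactSpace.1 hY
  have hzY : z ∈ Y := hz ▸ MulAction.mem_orbit_self z
  have : Nonempty Y := ⟨⟨z, hzY⟩⟩
  -- The orbit splits into countably many sets `S σ`, one for each coset of the stabilizer of `D`;
  -- Baire category makes the closure of one of them fat.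
  let S : (D → ℕ) → Set X := fun σ => {w | ∃ g : G, (∀ k : D, (g : Equiv.Perm ℕ) k = σ k) ∧ g • z = w}
  obtain ⟨σ, w, hw⟩ : ∃ σ, (interior ((↑) ⁻¹' closure (S σ) : Set Y)).Nonempty := by
    refine nonempty_interior_of_iUnion_of_closed
      (fun σ => isClosed_closure.preimage continuous_subtype_val) ?_
    refine Set.eq_univ_of_forall fun w => ?_
    obtain ⟨g, hg⟩ : (w : X) ∈ MulAction.orbit G z := hz ▸ w.2
    exact Set.mem_iUnion.2 ⟨fun k => (g : Equiv.Perm ℕ) k,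
      subset_closure ⟨g, fun _ => rfl, hg⟩⟩
  obtain ⟨O, hO, hOeq⟩ := isOpen_induced_iff.1
    (isOpen_interior (s := ((↑) ⁻¹' closure (S σ) : Set Y)))
  have hOS : ∀ u ∈ Y, u ∈ O → u ∈ closure (S σ) := by
    intro u hu huO
    have : (⟨u, hu⟩ : Y) ∈ (↑) ⁻¹' O := huO
    rw [hOeq] at this
    exact (interior_subset this : (⟨u, hu⟩ : Y) ∈ (↑) ⁻¹' closure (S σ))
  have hwO : (w : X) ∈ O := by rw [← hOeq] at hw; exact hw
  obtain ⟨_, hgO, g, hg, rfl⟩ := mem_closure_iff.1 (hOS w w.2 hwO) O hO hwO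
  -- Translating by `g⁻¹` carries `S σ` into the local orbit of `z`, because elements of `G`
  -- agreeing on `D` differ by an element of the stabilizer.
  refine ⟨(g • ·) ⁻¹' O, hO.preimage (continuous_const_smul g), hgO, ?_⟩
  rintro u ⟨huO, huY⟩
  have hguY : g • u ∈ Y := by
    rw [hz] at huY ⊢
    exact MulAction.mem_orbit_of_mem_orbit g huY
  have := map_mem_closure (continuous_const_smul g⁻¹) (hOS _ hguY huO)
    (t := MulAction.orbit (pointwiseStabilizer G D) z) (by
      rintro _ ⟨g', hg', rfl⟩
      dsimp only
      rw [← mul_smul]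
      refine smul_mem_orbit_of_mem (fun k hk => ?_) z
      rw [Subgroup.coe_mul, Equiv.Perm.mul_apply, hg' ⟨k, hk⟩, ← hg ⟨k, hk⟩]
      simp)
  simpa using this

/-- In a compact orbit, points that are close enough to each other have local orbits with the same
closure. -/
theorem exists_dist_lt_mem_closure_local_orbit [MetricSpace X] [ContinuousSMul G X]
    {Y : Set X} (hY : IsCompact Y) {x : X} (hx : Y = MulAction.orbit G x) (D : Finset ℕ) :
    ∃ δ > 0, ∀ u ∈ Y, ∀ w ∈ Y, dist u w < δ →
      u ∈ closure (MulAction.orbit (pointwiseStabilizer G D) w) := by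
  have horb : ∀ z ∈ Y, Y = MulAction.orbit G z := fun z hz => by
    rw [hx] at hz ⊢
    exact (MulAction.orbit_eq_iff.2 hz).symm
  have hopen := fun z : Y => exists_open_subset_closure_local_orbit hY (horb z z.2) D
  choose U hUo hzU hU using hopen
  obtain ⟨δ, hδ, hball⟩ := lebesgue_number_lemma_of_metric hY hUo
    fun z hz => Set.mem_iUnion.2 ⟨⟨z, hz⟩, hzU _⟩
  refine ⟨δ, hδ, fun u hu w hw huw => ?_⟩
  obtain ⟨z, hz⟩ := hball w hw
  have hw_mem := hU z ⟨hz (Metric.mem_ball_self hδ), hw⟩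
  refine mem_closure_orbit_trans (hU z ⟨hz huw, hu⟩) ?_
  -- Symmetry of the closure relation: some `v • z` falls into the neighbourhood of `w` where the
  -- local orbit of `w` is dense, and `v⁻¹` brings this back to `z`.
  obtain ⟨_, hvU, v, rfl⟩ := mem_closure_iff.1 hw_mem _ (hUo ⟨w, hw⟩) (hzU _)
  have hvY : v • (z : X) ∈ Y := by
    exact (horb z z.2).symm.subset (MulAction.mem_orbit (z : X) (v : G))
  have := smul_mem_closure_orbit (v⁻¹).2 (hU ⟨w, hw⟩ ⟨hvU, hvY⟩)
  simpa [Subgroup.smul_def] using this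

end CompactOrbits

/-! ### Canonical pieces -/

theorem mem_saturation {A : Set X} {x : X} : x ∈ saturation G A ↔ ∃ g : G, g • x ∈ A := by
  simp only [saturation, Set.mem_iUnion, Set.mem_smul_set_iff_inv_smul_mem]
  exact ⟨fun ⟨g, hg⟩ => ⟨g⁻¹, hg⟩, fun ⟨g, hg⟩ => ⟨g⁻¹, by simpa using hg⟩⟩

theorem smul_mem_saturation_iff {A : Set X} {x : X} (g : G) :
    g • x ∈ saturation G A ↔ x ∈ saturation G A := by
  simp only [mem_saturation, ← mul_smul]
  exact ⟨fun ⟨h, hh⟩ => ⟨_, hh⟩, fun ⟨h, hh⟩ => ⟨h * g⁻¹, by simpa using hh⟩⟩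

namespace IsCanonicalPiece

variable {𝒜 : Set (Set X)} {Y Z : Set X}

/-- As `Y` is non-empty, the index set `T` is recovered from it. -/
theorem mem_iff (hY : IsCanonicalPiece G 𝒜 Y) {x : X} :
    x ∈ Y ↔ ∀ A ∈ 𝒜, x ∈ saturation G A ↔ Y ⊆ saturation G A := by
  obtain ⟨⟨y, hy⟩, T, hT, hYT⟩ := hY
  have hmem : ∀ z, z ∈ Y ↔ ∀ A ∈ 𝒜, z ∈ saturation G A ↔ A ∈ T := by
    intro z
    simp only [hYT, Set.mem_inter_iff, Set.mem_iInter, Set.mem_compl_iff, Set.mem_sdiff]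
    constructor
    · rintro ⟨h1, h2⟩ A hA
      exact ⟨fun h => by_contra fun hAT => h2 A ⟨hA, hAT⟩ h, h1 A⟩
    · exact fun h => ⟨fun A hA => (h A (hT hA)).2 hA, fun A hA hz => hA.2 ((h A hA.1).1 hz)⟩
  have hsub : ∀ A ∈ 𝒜, Y ⊆ saturation G A ↔ A ∈ T := fun A hA =>
    ⟨fun h => ((hmem y).1 hy A hA).1 (h hy), fun h z hz => ((hmem z).1 hz A hA).2 h⟩
  rw [hmem]
  exact forall₂_congr fun A hA => by rw [hsub A hA]

theorem smul_mem (hY : IsCanonicalPiece G 𝒜 Y) (g : G) {x : X} (hx : x ∈ Y) : g • x ∈ Y :=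
  hY.mem_iff.2 fun A hA => (smul_mem_saturation_iff g).trans (hY.mem_iff.1 hx A hA)

/-- A basic set containing a point of `Y` has a saturation covering `Y`, so it meets every orbit in
`Y`. -/
theorem mem_closure_orbit [TopologicalSpace X] (hY : IsCanonicalPiece G 𝒜 Y)
    (h𝒜 : TopologicalSpace.IsTopologicalBasis 𝒜) {x y : X} (hx : x ∈ Y) (hy : y ∈ Y) :
    y ∈ closure (MulAction.orbit G x) := by
  refine h𝒜.mem_closure_iff.2 fun A hA hyA => ?_
  have hsub := (hY.mem_iff.1 hy A hA).1 (mem_saturation.2 ⟨1, by simpa using hyA⟩)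
  obtain ⟨g, hg⟩ := mem_saturation.1 (hsub hx)
  exact ⟨g • x, hg, MulAction.mem_orbit x g⟩

theorem eq_of_codes {νA : FamilyNumbering 𝒜} {e : ℕ} (hY : IsCanonicalPiece G 𝒜 Y)
    (hZ : IsCanonicalPiece G 𝒜 Z) (hYe : Codes (G := G) νA e Y) (hZe : Codes (G := G) νA e Z) :
    Y = Z := by
  have key : ∀ A ∈ 𝒜, Y ⊆ saturation G A ↔ Z ⊆ saturation G A := by
    intro A hA
    obtain ⟨n, hn, rfl⟩ := νA.bijOn.surjOn hA
    have := Part.some_injective ((hYe n).symm.trans (hZe n))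
    split_ifs at this <;> tauto
  ext x
  rw [hY.mem_iff, hZ.mem_iff]
  exact forall₂_congr fun A hA => by rw [key A hA]

theorem conRel_iff {ℬ : Set (Set X)} {νA : FamilyNumbering 𝒜} {νB : FamilyNumbering ℬ} {e b : ℕ}
    (hY : IsCanonicalPiece G 𝒜 Y) (hYe : Codes (G := G) νA e Y) :
    ConRel G νA νB e b ↔ b ∈ νB.dom ∧ (νB.val b ∩ Y).Nonempty := by
  constructor
  · rintro ⟨hb, Z, hZ, hne, hZe⟩
    exact ⟨hb, hY.eq_of_codes hZ hYe hZe ▸ hne⟩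
  · rintro ⟨hb, hne⟩
    exact ⟨hb, Y, hY, hne, hYe⟩

end IsCanonicalPiece

/-! ### The combinatorial condition on a piece -/

/-- Any two points of `Y` contained in a small basic clopen set have local orbits that cannot be
separated by elements of `𝒜`. -/
def HasUniformLocalOrbits (G : Subgroup (Equiv.Perm ℕ)) {X : Type*} [MulAction G X] [MetricSpace X]
    (𝒜 : Set (Set X)) (Y : Set X) : Prop :=
  ∀ D : Finset ℕ, ∃ i : ℕ, ∀ A ∈ 𝒜, IsClopen A → DiamLT (fun x y : X => dist x y) A i →
    ∀ A' ∈ 𝒜, (A ∩ A' ∩ Y).Nonempty →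
      ∀ w ∈ A ∩ Y, ∃ g ∈ pointwiseStabilizer G D, g • w ∈ A'

/-- The clopen members form only a subbasis, so the whole space may have to be added to obtain a
basis. If no clopen member contains `x`, the only neighbourhood of `x` is the whole space, which
then belongs to `𝒜` and is clopen, a contradiction. -/
theorem IsAdmissibleBasis.exists_clopen_diamLT [MetricSpace X] {𝒜 : Set (Set X)}
    (h𝒜 : IsAdmissibleBasis G 𝒜) (x : X) (i : ℕ) :
    ∃ A ∈ 𝒜, IsClopen A ∧ x ∈ A ∧ DiamLT (fun x y : X => dist x y) A i := by
  have hbasis : TopologicalSpace.IsTopologicalBasis (insert Set.univ {A ∈ 𝒜 | IsClopen A}) :=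
    TopologicalSpace.isTopologicalBasis_of_subbasis_of_inter h𝒜.clopen_generate.symm
      fun A hA B hB => ⟨h𝒜.inter_mem A hA.1 B hB.1, hA.2.inter hB.2⟩
  by_cases hx : ∃ A ∈ 𝒜, IsClopen A ∧ x ∈ A
  · obtain ⟨A₀, hA₀, hclo₀, hxA₀⟩ := hx
    have hpos : (0 : ℝ) < (1 / 2) ^ i := by positivity
    obtain ⟨A, hA, hxA, hsub⟩ := hbasis.exists_subset_of_mem_open
      (show x ∈ A₀ ∩ Metric.ball x ((1 / 2 : ℝ) ^ i / 4) from
        ⟨hxA₀, Metric.mem_ball_self (by positivity)⟩) (hclo₀.isOpen.inter Metric.isOpen_ball)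
    have hA' : A ∈ 𝒜 ∧ IsClopen A := by
      rcases hA with rfl | hA
      · have : A₀ = Set.univ := Set.eq_univ_of_univ_subset (hsub.trans Set.inter_subset_left)
        exact this ▸ ⟨hA₀, hclo₀⟩
      · exact hA
    refine ⟨A, hA'.1, hA'.2, hxA, (1 / 2 : ℝ) ^ i / 2, by linarith, fun u hu w hw => ?_⟩
    have h1 := (hsub hu).2
    have h2 := (hsub hw).2
    rw [Metric.mem_ball] at h1 h2
    have := dist_triangle_right u w x
    linarith
  · have huniv : ∀ U : Set X, IsOpen U → x ∈ U → U = Set.univ := by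
      intro U hU hxU
      obtain ⟨A, hA, hxA, hsub⟩ := hbasis.exists_subset_of_mem_open hxU hU
      rcases hA with rfl | hA
      · exact Set.eq_univ_of_univ_subset hsub
      · exact absurd ⟨A, hA.1, hA.2, hxA⟩ hx
    obtain ⟨A, hA, hxA, -⟩ := h𝒜.basis.exists_subset_of_mem_open (Set.mem_univ x) isOpen_univ
    exact absurd ⟨A, hA, huniv A (h𝒜.basis.isOpen hA) hxA ▸ isClopen_univ, hxA⟩ hx

theorem HasUniformLocalOrbits.exists_eq_orbit [MetricSpace X] [ContinuousSMul G X]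
    {𝒜 : Set (Set X)} {Y : Set X} (hG : IsClosed (G : Set (Equiv.Perm ℕ)))
    (h𝒜 : IsAdmissibleBasis G 𝒜) (hY : IsCanonicalPiece G 𝒜 Y)
    (h : HasUniformLocalOrbits G 𝒜 Y) : ∃ x : X, Y = MulAction.orbit G x := by
  obtain ⟨x, hx⟩ := hY.1
  refine ⟨x, Set.Subset.antisymm (fun y hy => ?_) ?_⟩
  · refine mem_orbit_of_locally_dense hG (fun g z hz => hY.smul_mem g hz) (fun D z _ => ?_) hx hy
      (hY.mem_closure_orbit h𝒜.basis hx hy)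
    obtain ⟨i, hi⟩ := h D
    obtain ⟨A, hA, hclo, hzA, hdiam⟩ := h𝒜.exists_clopen_diamLT z i
    refine ⟨A, hclo.isOpen.mem_nhds hzA, fun u hu w hw => ?_⟩
    refine h𝒜.basis.mem_closure_iff.2 fun A' hA' huA' => ?_
    obtain ⟨g, hg, hgw⟩ := hi A hA hclo hdiam A' hA' ⟨u, ⟨hu.1, huA'⟩, hu.2⟩ w hw
    exact ⟨g • w, hgw, smul_mem_orbit_of_mem hg w⟩
  · rintro _ ⟨g, rfl⟩
    exact hY.smul_mem g hx

theorem hasUniformLocalOrbits_of_isCompact_orbit [MetricSpace X] [ContinuousSMul G X]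
    {𝒜 : Set (Set X)} {Y : Set X} (h𝒜 : ∀ A ∈ 𝒜, IsOpen A) (hY : IsCompact Y) {x : X}
    (hx : Y = MulAction.orbit G x) : HasUniformLocalOrbits G 𝒜 Y := by
  intro D
  obtain ⟨δ, hδ, hclose⟩ := exists_dist_lt_mem_closure_local_orbit hY hx D
  obtain ⟨i, hi⟩ := exists_pow_lt_of_lt_one hδ (by norm_num : (1 / 2 : ℝ) < 1)
  refine ⟨i, ?_⟩
  rintro A - - ⟨r, hr, hdiam⟩ A' hA' ⟨u, ⟨huA, huA'⟩, huY⟩ w ⟨hwA, hwY⟩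
  have hu := hclose u huY w hwY ((hdiam u huA w hwA).trans_lt (hr.trans hi))
  obtain ⟨_, hv, v, rfl⟩ := mem_closure_iff.1 hu A' (h𝒜 A' hA') huA'
  exact ⟨v, v.2, hv⟩

/-! ### The condition in terms of numbers -/

namespace IsNiceBasis

variable [TopologicalSpace X] {ℬ : Set (Set X)}

theorem compl_mem (hℬ : IsNiceBasis G ℬ) {B : Set X} (hB : B ∈ ℬ) : Bᶜ ∈ ℬ :=
  hℬ.choose_spec.compl_mem B hB

theorem inter_mem (hℬ : IsNiceBasis G ℬ) {B C : Set X} (hB : B ∈ ℬ) (hC : C ∈ ℬ) : B ∩ C ∈ ℬ :=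
  hℬ.choose_spec.inter_mem B hB C hC

theorem vaughtStar_mem (hℬ : IsNiceBasis G ℬ) {B : Set X} (hB : B ∈ ℬ) {u : Set G}
    (hu : u ∈ basicSets G) : vaughtStar B u ∈ ℬ :=
  hℬ.choose_spec.vaughtStar_mem B hB u hu

theorem vaughtDelta_mem (hℬ : IsNiceBasis G ℬ) {B : Set X} (hB : B ∈ ℬ) {u : Set G}
    (hu : u ∈ basicSets G) : vaughtDelta B u ∈ ℬ :=
  hℬ.compl_mem (hℬ.vaughtStar_mem (hℬ.compl_mem hB) hu)

end IsNiceBasis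

/-- The numbers `q = (a, a', k, d, c, m)` witness the following: `A_a` is clopen of
diameter less than `2^(-i)`, `A_k = A_a ∩ A_a'`, and `B_m` is the set of those elements of `A_a`
which the `v`-th basic subgroup does not move into `A_a'`. -/
def IsTest (G : Subgroup (Equiv.Perm ℕ)) {X : Type*} [MulAction G X] [MetricSpace X]
    {𝒜 ℬ : Set (Set X)} (νN : FamilyNumbering (basicSets G)) (νA : FamilyNumbering 𝒜)
    (νB : FamilyNumbering ℬ) (f : ℕ → ℕ) (v i : ℕ) (q : ℕ × ℕ × ℕ × ℕ × ℕ × ℕ) : Prop :=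
  (v ∈ νN.dom ∧ νN.val v ∈ basicSubgroups G) ∧
  (q.1 ∈ νA.dom ∧ IsClopen (νA.val q.1) ∧ DiamLT (fun x y : X => dist x y) (νA.val q.1) i) ∧
  (q.1 ∈ νA.dom ∧ q.2.1 ∈ νA.dom ∧ q.2.2.1 ∈ νA.dom ∧
    νA.val q.1 ∩ νA.val q.2.1 = νA.val q.2.2.1) ∧
  (f q.2.1 ∈ νB.dom ∧ v ∈ νN.dom ∧ q.2.2.2.1 ∈ νB.dom ∧
    vaughtDelta (νB.val (f q.2.1)) (νN.val v) = νB.val q.2.2.2.1) ∧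
  (q.2.2.2.1 ∈ νB.dom ∧ q.2.2.2.2.1 ∈ νB.dom ∧
    νB.val q.2.2.2.2.1 = (νB.val q.2.2.2.1)ᶜ) ∧
  (f q.1 ∈ νB.dom ∧ q.2.2.2.2.1 ∈ νB.dom ∧ q.2.2.2.2.2 ∈ νB.dom ∧
    νB.val (f q.1) ∩ νB.val q.2.2.2.2.1 = νB.val q.2.2.2.2.2)

section Numbers

variable [MetricSpace X] {𝒜 ℬ : Set (Set X)} {νN : FamilyNumbering (basicSets G)}
  {νA : FamilyNumbering 𝒜} {νB : FamilyNumbering ℬ} {f : ℕ → ℕ}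

/-- A violation at `A`, `A'` is a point of `Y` in `A` outside the local saturation of `A'`, while `A
∩ A'` meets `Y`; the closure properties of `𝒜` and `ℬ` supply numbers for all sets involved. -/
theorem hasUniformLocalOrbits_iff_forall_test [ContinuousSMul G X]
    (hG : IsClosed (G : Set (Equiv.Perm ℕ))) (h𝒜 : IsAdmissibleBasis G 𝒜) (hℬ : IsNiceBasis G ℬ)
    (hf : ∀ n ∈ νA.dom, f n ∈ νB.dom ∧ νB.val (f n) = νA.val n) {Y : Set X} :
    HasUniformLocalOrbits G 𝒜 Y ↔ ∀ v, ∃ i, ∀ q, IsTest G νN νA νB f v i q →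
      ¬ ((νB.val (f q.2.2.1) ∩ Y).Nonempty ∧ (νB.val q.2.2.2.2.2 ∩ Y).Nonempty) := by
  constructor
  · intro h v
    by_cases hv : νN.val v ∈ basicSubgroups G
    · obtain ⟨D, hD⟩ := mem_basicSubgroups.1 hv
      obtain ⟨i, hi⟩ := h D
      refine ⟨i, ?_⟩
      rintro ⟨a, a', k, d, c, m⟩
      rintro ⟨-, ⟨ha, hclo, hdiam⟩, ⟨-, ha', hk, hak⟩, ⟨-, -, -, hd⟩, ⟨-, -, hc⟩, ⟨-, -, -, hm⟩⟩
        ⟨hne, w, hw, hwY⟩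
      dsimp only at *
      rw [(hf k hk).2, ← hak] at hne
      rw [← hm, hc, ← hd, (hf a ha).2, (hf a' ha').2, hD] at hw
      refine hw.2 ((mem_vaughtDelta_iff hG D (h𝒜.basis.isOpen (νA.bijOn.mapsTo ha'))).2 ?_)
      exact hi _ (νA.bijOn.mapsTo ha) hclo hdiam _ (νA.bijOn.mapsTo ha') hne w ⟨hw.1, hwY⟩
    -- No test exists if `v` does not number a basic subgroup, so any scale works.
    · exact ⟨0, fun q hq => absurd hq.1.2 hv⟩
  · intro h D
    obtain ⟨v, hv, hvD⟩ := νN.bijOn.surjOn (pointwiseStabilizer_mem_basicSets (G := G) D)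
    obtain ⟨i, hi⟩ := h v
    refine ⟨i, fun A hA hclo hdiam A' hA' hne w hw => ?_⟩
    by_contra hw'
    obtain ⟨a, ha, rfl⟩ := νA.bijOn.surjOn hA
    obtain ⟨a', ha', rfl⟩ := νA.bijOn.surjOn hA'
    obtain ⟨k, hk, hak⟩ := νA.bijOn.surjOn (h𝒜.inter_mem _ hA _ hA')
    have hΔ := hℬ.vaughtDelta_mem (νB.bijOn.mapsTo (hf a' ha').1) (νN.bijOn.mapsTo hv)
    obtain ⟨d, hd, hdeq⟩ := νB.bijOn.surjOn hΔ
    obtain ⟨c, hc, hceq⟩ := νB.bijOn.surjOn (hℬ.compl_mem hΔ)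
    obtain ⟨m, hm, hmeq⟩ := νB.bijOn.surjOn
      (hℬ.inter_mem (νB.bijOn.mapsTo (hf a ha).1) (νB.bijOn.mapsTo hc))
    refine hi (a, a', k, d, c, m) ⟨⟨hv, D, hvD⟩, ⟨ha, hclo, hdiam⟩, ⟨ha, ha', hk, hak.symm⟩,
      ⟨(hf a' ha').1, hv, hd, hdeq.symm⟩, ⟨hd, hc, by rw [hceq, hdeq]⟩,
      ⟨(hf a ha).1, hc, hm, hmeq.symm⟩⟩ ⟨?_, w, ?_, hw.2⟩
    · dsimp only
      rwa [(hf k hk).2, hak]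
    · dsimp only
      rw [hmeq, hceq, (hf a ha).2, (hf a' ha').2, hvD]
      exact ⟨hw.1, fun hΔw =>
        hw' ((mem_vaughtDelta_iff hG D (h𝒜.basis.isOpen hA')).1 hΔw)⟩

open Classical in
theorem computableIn_isTest (hcomp : IsComputableBasis νN νA νB) (hf : Computable f)
    (O : Set (ℕ →. ℕ)) :
    ComputableIn O fun p : ℕ × ℕ × ℕ × ℕ × ℕ × ℕ × ℕ × ℕ =>
      decide (IsTest G νN νA νB f p.1 p.2.1 p.2.2) := by
  have hv : Computable fun p : ℕ × ℕ × ℕ × ℕ × ℕ × ℕ × ℕ × ℕ => p.1 := .fst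
  have h2 : Computable fun p : ℕ × ℕ × ℕ × ℕ × ℕ × ℕ × ℕ × ℕ => p.2 := .snd
  have h3 := Computable.snd.comp h2
  have h4 := Computable.snd.comp h3
  have h5 := Computable.snd.comp h4
  have h6 := Computable.snd.comp h5
  have h7 := Computable.snd.comp h6
  have hi := Computable.fst.comp h2
  have ha := Computable.fst.comp h3
  have ha' := Computable.fst.comp h4
  have hk := Computable.fst.comp h5
  have hd := Computable.fst.comp h6
  have hc := Computable.fst.comp h7
  have hm := Computable.snd.comp h7
  have hpres := hcomp.presentation
  have := (ComputableIn.decide_comp (O := O) hpres.basicSubgroup_N hv).and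
    ((ComputableIn.decide_comp hpres.diam_A (ha.pair hi)).and
    ((ComputableIn.decide_comp hpres.inter_A (ha.pair (ha'.pair hk))).and
    ((ComputableIn.decide_comp hcomp.vaughtDelta_B ((hf.comp ha').pair (hv.pair hd))).and
    ((ComputableIn.decide_comp hcomp.compl_B (hd.pair hc)).and
    (ComputableIn.decide_comp hcomp.inter_B ((hf.comp ha).pair (hc.pair hm)))))))
  convert this using 2 with p
  rw [Bool.eq_iff_iff, decide_eq_true_eq]
  simp only [IsTest, decide_eq_true_eq, Bool.and_eq_true]

open Classical in
-- The conjunct `ConRel G νA νB e ib.2` forces `e` to code a piece; its witness is absorbed into the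
-- existential quantifier over scales.
theorem isPiThreeIn_setOf_tests (hcomp : IsComputableBasis νN νA νB) (hf : Computable f) :
    IsPiThreeIn (ConRel G νA νB) {e | ∀ v, ∃ ib : ℕ × ℕ, ∀ q, ConRel G νA νB e ib.2 ∧
      (IsTest G νN νA νB f v ib.1 q →
        ¬ (ConRel G νA νB e (f q.2.2.1) ∧ ConRel G νA νB e q.2.2.2.2.2))} := by
  have hnat : ∃ s : ℕ → ℕ, Computable s ∧ s.Surjective :=
    ⟨id, Computable.id, Function.surjective_id⟩
  have hnat₂ := exists_computable_surjective_nat_prod hnat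
  have hnat₆ := exists_computable_surjective_nat_prod (exists_computable_surjective_nat_prod
    (exists_computable_surjective_nat_prod (exists_computable_surjective_nat_prod hnat₂)))
  have he : Computable fun p : ℕ × ℕ × (ℕ × ℕ) × (ℕ × ℕ × ℕ × ℕ × ℕ × ℕ) => p.1 := .fst
  have h2 : Computable fun p : ℕ × ℕ × (ℕ × ℕ) × (ℕ × ℕ × ℕ × ℕ × ℕ × ℕ) => p.2 := .snd
  have hv := Computable.fst.comp h2
  have h3 := Computable.snd.comp h2
  have hib := Computable.fst.comp h3
  have hq := Computable.snd.comp h3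
  have hk := Computable.fst.comp (Computable.snd.comp (Computable.snd.comp hq))
  have hm := Computable.snd.comp (Computable.snd.comp (Computable.snd.comp
    (Computable.snd.comp (Computable.snd.comp hq))))
  have hC := fun {g : ℕ × ℕ × (ℕ × ℕ) × (ℕ × ℕ × ℕ × ℕ × ℕ × ℕ) → ℕ} (hg : Computable g) =>
    (computableIn_relOracle (ConRel G νA νB)).comp (he.pair hg).computableIn
  have htest := (computableIn_isTest hcomp hf {relOracle (ConRel G νA νB)}).comp
    (hv.pair ((Computable.fst.comp hib).pair hq)).computableIn
  have hall := (hC (Computable.snd.comp hib)).and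
    (htest.and ((hC (hf.comp hk)).and (hC hm))).not
  refine isPiThreeIn_of_surjective hnat hnat₂ hnat₆ hall fun e => ?_
  refine forall_congr' fun v => exists_congr fun ib => forall_congr' fun q => ?_
  simp only [Bool.and_eq_true, Bool.not_eq_true', decide_eq_true_eq, ← Bool.not_eq_true, not_and]

end Numbers

end PolishAction

/-! ### The set of codes -/

open PolishAction
theorem proposition2p5
    (G : Subgroup (Equiv.Perm ℕ)) (hG : IsClosed (G : Set (Equiv.Perm ℕ)))
    {X : Type*} [MetricSpace X] [PolishSpace X] [CompactSpace X]
    [MulAction G X] [ContinuousSMul G X]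
    (𝒜 : Set (Set X)) (h𝒜 : IsAdmissibleBasis G 𝒜)
    (ℬ : Set (Set X)) (hℬ : IsNiceBasis G ℬ)
    (νN : FamilyNumbering (basicSets G)) (νA : FamilyNumbering 𝒜) (νB : FamilyNumbering ℬ)
    (hcomp : IsComputableBasis νN νA νB) :
    ∃ 𝒪 : Set ℕ,
      (∀ e ∈ 𝒪, ∃ Y : Set X, IsCanonicalPiece G 𝒜 Y ∧ Codes (G := G) νA e Y ∧
        ∃ x : X, Y = MulAction.orbit G x) ∧
      (∀ (e : ℕ) (Y : Set X), IsCanonicalPiece G 𝒜 Y → IsClosed Y →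
        (∃ x : X, Y = MulAction.orbit G x) → Codes (G := G) νA e Y → e ∈ 𝒪) ∧
      IsPiThreeIn (ConRel G νA νB) 𝒪 := by
  obtain ⟨f, hf, hfν⟩ := hcomp.translation
  refine ⟨_, fun e he => ?_, fun e Y hY hclosed hx heY => ?_, isPiThreeIn_setOf_tests hcomp hf⟩
  · obtain ⟨ib, hib⟩ := he 0
    -- The first conjunct does not depend on the tuple, so any tuple will do.
    obtain ⟨-, Y, hY, -, heY⟩ := (hib (0, 0, 0, 0, 0, 0)).1
    refine ⟨Y, hY, heY, HasUniformLocalOrbits.exists_eq_orbit hG h𝒜 hY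
      ((hasUniformLocalOrbits_iff_forall_test (νN := νN) hG h𝒜 hℬ hfν).2 fun v => ?_)⟩
    obtain ⟨ib, hib⟩ := he v
    refine ⟨ib.1, fun q hq hne => (hib q).2 hq ?_⟩
    rw [hY.conRel_iff heY, hY.conRel_iff heY]
    exact ⟨⟨(hfν _ hq.2.2.1.2.2.1).1, hne.1⟩, hq.2.2.2.2.2.2.2.1, hne.2⟩
  · intro v
    obtain ⟨x, hx⟩ := hx
    obtain ⟨i, hi⟩ := (hasUniformLocalOrbits_iff_forall_test (νN := νN) hG h𝒜 hℬ hfν).1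
      (hasUniformLocalOrbits_of_isCompact_orbit (fun A hA => h𝒜.basis.isOpen hA)
        hclosed.isCompact hx) v
    obtain ⟨y, hy⟩ := hY.1
    -- Any basic set meeting `Y` certifies that `e` codes a piece.
    obtain ⟨A, hA, hyA, -⟩ := h𝒜.basis.exists_subset_of_mem_open (Set.mem_univ y) isOpen_univ
    obtain ⟨n, hn, rfl⟩ := νA.bijOn.surjOn hA
    refine ⟨(i, f n), fun q => ⟨(hY.conRel_iff heY).2 ⟨(hfν n hn).1, y, ?_, hy⟩, fun hq hcon => ?_⟩⟩
    · rw [(hfν n hn).2]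
      exact hyA
    · rw [hY.conRel_iff heY, hY.conRel_iff heY] at hcon
      exact hi q hq ⟨hcon.1.2, hcon.2.2⟩
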